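/- Theorem (Existence of Nash Equilibrium). Let $\mathcal X$ be a measurable instance space, $\mathcal Y$ a label set, $\mathcal H$ a class of functions $\mathcal X\to\mathcal Y$, $\varepsilon,\delta\in\mathbb R$, and let agents $i=1,\dots,k$ have probability distributions $\mathcal D_i$ on $\mathcal X$ and per-sample costs $c_i>0$. In the contribution game each agent $i$ chooses $m_i\in\mathbb N=\{0,1,2,\dots\}$. For a target $h^\star\in\mathcal H$, the pooled dataset $S$ consists of $m_i$ i.i.d. points from $\mathcal D_i$ for every $i$ (independently over agents), all labeled by $h^\star$. Let $\mathrm{ERM}(S)\subseteq\mathcal H$ be the set of minimizers over $\mathcal H$ of the empirical error on $S$ (the fraction of mislabeled points, taken to be $0$ if $S$ is empty). Put $a_i(\mathbf m)=1$ if for every $h^\star\in\mathcal H$ $$\Pr_S\Bigl[\sup_{h\in \mathrm{ERM}(S)}\Pr_{x\sim\mathcal D_i}[h(x)\ne h^\star(x)]\le\varepsilon\Bigr]\ge 1-\delta,$$ and $a_i(\mathbf m)=0$ otherwise. The utility of agent $i$ is $u_i(\mathbf m)=a_i(\mathbf m)-c_i m_i$. Assume: 1. (Self-sufficiency) for every agent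 $i$ there is an $n$ such that $a_i=1$ at the profile in which $i$ contributes $n$ samples and all others contribute $0$, and the smallest such $n$, denoted $n_i^{\mathrm{ind}}$, satisfies $c_i n_i^{\mathrm{ind}}<1$; 2. (Monotonicity) more data from other agents never hurts an agent: $u_i(\mathbf m')\ge u_i(\mathbf m)$ for every agent $i$ and all profiles $\mathbf m,\mathbf m'$ with $m_j'\ge m_j$ for all $j$ and $m_i'=m_i$. Then the game has a (possibly mixed) Nash equilibrium: there are probability distributions $\sigma_1,\dots,\sigma_k$ on $\mathbb N$ such that, for every agent $i$ and every probability distribution $\tau$ on $\mathbb N$, the expected utility of $i$ when the contributions are drawn independently from $\sigma_1,\dots,\sigma_k$ is at least its expected utility when $\sigma_i$ is replaced by $\tau$. (As $u_i\le 1$, expected utilities are well defined in $[-\infty,1]$.) -/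

import Mathlib

open MeasureTheory

noncomputable section

namespace CollabLearning

/-! ### Learning protocol -/

section Learning

variable {X Y : Type*}

open Classical in
/-- Empirical error of `h` on a finite labeled dataset (a multiset of labeled points):
the fraction of mislabeled points, and `0` on the empty dataset. -/
def empError (S : Multiset (X × Y)) (h : X → Y) : ℝ :=
  (S.countP (fun z => h z.1 ≠ z.2) : ℝ) / (S.card : ℝ)

/-- The set of empirical risk minimizers over the class `H` on the dataset `S`. -/
def ERM (H : Set (X → Y)) (S : Multiset (X × Y)) : Set (X → Y) :=
  {h | h ∈ H ∧ ∀ h' ∈ H, empError S h ≤ empError S h'}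

/-- Generalization error `Pr_{x ∼ D} [h x ≠ hstar x]`. -/
def genError [MeasurableSpace X] (D : Measure X) (hstar h : X → Y) : ℝ :=
  D.real {x | h x ≠ hstar x}

/-- Worst generalization error over all empirical risk minimizers on `S`. The supremum is over
a set of numbers in `[0, 1]`, which is nonempty when `H` is nonempty. -/
def ermError [MeasurableSpace X] (H : Set (X → Y)) (D : Measure X) (hstar : X → Y)
    (S : Multiset (X × Y)) : ℝ :=
  sSup (genError D hstar '' ERM H S)

/-- The pooled dataset: all sampled points `U i j` (the `j`-th point of agent `i`), labeled by
the target `hstar`. -/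
def pooledDataset {k : ℕ} {m : Fin k → ℕ} (hstar : X → Y) (U : ∀ i, Fin (m i) → X) :
    Multiset (X × Y) :=
  (Finset.univ : Finset (Σ i, Fin (m i))).val.map
    (fun p => (U p.1 p.2, hstar (U p.1 p.2)))

/-- The law of the unlabeled samples: agent `i` draws `m i` i.i.d. points from `D i`,
independently of the other agents. -/
def sampleLaw [MeasurableSpace X] {k : ℕ} (D : Fin k → ProbabilityMeasure X) (m : Fin k → ℕ) :
    Measure (∀ i, Fin (m i) → X) :=
  Measure.pi (fun i => Measure.pi (fun _ : Fin (m i) => (D i : Measure X)))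

end Learning

/-! ### The contribution game -/

/-- The data of a contribution game with `k` agents: hypothesis class, marginal distributions,
accuracy and confidence parameters, and positive per-sample costs. -/
structure ContributionGame (k : ℕ) (X Y : Type*) [MeasurableSpace X] where
  /-- the hypothesis class -/
  H : Set (X → Y)
  /-- the marginal distributions of the agents -/
  D : Fin k → ProbabilityMeasure X
  /-- the error tolerance -/
  ε : ℝ
  /-- the failure probability -/
  δ : ℝ
  /-- the costs per sample -/
  c : Fin k → ℝ
  c_pos : ∀ i, 0 < c i

namespace ContributionGame

variable {k : ℕ} {X Y : Type*} [MeasurableSpace X] (G : ContributionGame k X Y)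

/-- The `(ε, δ)`-requirement of agent `i` at the contribution profile `m`: for every target in
the class, with probability at least `1 - δ` over the pooled sample, the worst empirical risk
minimizer has error at most `ε` on the distribution of agent `i`. -/
def Requirement (i : Fin k) (m : Fin k → ℕ) : Prop :=
  ∀ hstar ∈ G.H,
    1 - G.δ ≤ (sampleLaw G.D m).real
      {U | ermError G.H (G.D i : Measure X) hstar (pooledDataset hstar U) ≤ G.ε}

open Classical in
/-- The binary variable `a_i(m)`. -/
def accuracy (i : Fin k) (m : Fin k → ℕ) : ℝ :=
  if G.Requirement i m then 1 else 0

/-- The utility `u_i(m) = a_i(m) - c_i m_i`. -/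
def utility (i : Fin k) (m : Fin k → ℕ) : ℝ :=
  G.accuracy i m - G.c i * (m i : ℝ)

/-- `n` is the smallest number of own samples with which agent `i`, without contributions from
the others, meets its requirement. -/
def IsSoloCount (i : Fin k) (n : ℕ) : Prop :=
  IsLeast {n : ℕ | G.Requirement i (Pi.single i n)} n

/-- Self-sufficiency: every agent can meet its requirement alone, and the least number `n` of
samples that it needs for this satisfies `c_i n < 1`. -/
def SelfSufficient : Prop :=
  ∀ i, ∃ n, G.IsSoloCount i n ∧ G.c i * (n : ℝ) < 1

/-- Weak monotonicity: more data from other agents never hurts an agent. -/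
def Monotonicity : Prop :=
  ∀ (i : Fin k) (m m' : Fin k → ℕ), (∀ j, m j ≤ m' j) → m' i = m i →
    G.utility i m ≤ G.utility i m'

/-- Extended expectation, positive part minus negative part. It is well defined in `[-∞, C]` for
a function that is bounded above by a constant `C`. -/
def expectation {Ω : Type*} [MeasurableSpace Ω] (μ : Measure Ω) (f : Ω → ℝ) : EReal :=
  ((∫⁻ x, ENNReal.ofReal (f x) ∂μ : ENNReal) : EReal) -
    ((∫⁻ x, ENNReal.ofReal (-f x) ∂μ : ENNReal) : EReal)

/-- Expected utility of agent `i` when the agents independently draw their contributions from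
the mixed strategies `σ`, which are arbitrary probability distributions on `ℕ`. Utilities are at
most `1`, so the expectation is well defined in `[-∞, 1]`. -/
def expectedUtility (i : Fin k) (σ : Fin k → ProbabilityMeasure ℕ) : EReal :=
  expectation (Measure.pi (fun j => (σ j : Measure ℕ))) (G.utility i)

/-- A (possibly mixed) Nash equilibrium: no agent can raise its expected utility by switching
unilaterally to another mixed strategy. -/
def IsNashEquilibrium (σ : Fin k → ProbabilityMeasure ℕ) : Prop :=
  ∀ (i : Fin k) (τ : ProbabilityMeasure ℕ),
    G.expectedUtility i (Function.update σ i τ) ≤ G.expectedUtility i σ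

end ContributionGame

end CollabLearning

end

/-!
The infinite game reduces to a finite one. Once agent `i` contributes its solo count `n i`,
monotonicity guarantees its requirement whatever the others do
(`utility_eq_of_isSoloCount`), so contributing more only adds cost
(`utility_update_le_of_isSoloCount`). With `N` at least every solo count, a mixed equilibrium of the
game restricted to the contributions `0, …, N` is therefore an equilibrium of the original game:
no pure deviation helps, and the expected utility of a mixed deviation `τ` is the `τ`-average of
those of pure deviations by Fubini (`expectedUtility_update_le`), or `-∞`.

The finite game has a mixed equilibrium by Nash's argument (`exists_mixed_nash_equilibrium`): the
map that shifts weight towards the actions with positive gain has a fixed point on the product of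
the strategy simplices.

The fixed point comes from Brouwer's theorem, proved analytically after Milnor and Rogers. Suppose
that `f` is a `C¹` retraction of the closed unit ball onto the sphere and let `g` be `f - id` on the
ball and `0` outside. As `g` is Lipschitz, `id + t • g` is for small `t > 0` a bijection of the space
that fixes the outside of the ball, so it maps the ball onto itself and the integral of
`det (1 + t • Dg)` over the ball is its volume. Being polynomial in `t`, this integral is the volume
at `t = 1` too (`integral_det_one_add_eq`); but there the integrand is `det Df = 0`, because `‖f‖` is
constant. A `C¹` self-map of the ball without fixed points would yield such a retraction, along the
rays from `p x` through `x`, and continuous maps are approximated by smooth ones.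
-/

/-! ### Brouwer's fixed point theorem -/

section Brouwer

open Metric Set Filter Topology
open scoped NNReal

variable {E : Type*} [NormedAddCommGroup E]

theorem bijective_id_add_of_lipschitzWith [NormedSpace ℝ E] [CompleteSpace E] {g : E → E} {K : ℝ≥0}
    (hg : LipschitzWith K g) (hK : K < 1) : Function.Bijective fun x => x + g x := by
  have happ : ApproximatesLinearOn (fun x => x + g x)
      ((ContinuousLinearEquiv.refl ℝ E : E ≃L[ℝ] E) : E →L[ℝ] E) univ K := by
    rw [ApproximatesLinearOn.approximatesLinearOn_iff_lipschitzOnWith, lipschitzOnWith_univ]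
    convert hg using 1
    ext x
    simp
  have hc : Subsingleton E ∨
      K < ‖((ContinuousLinearEquiv.refl ℝ E).symm : E →L[ℝ] E)‖₊⁻¹ := by
    rcases subsingleton_or_nontrivial E with h | h
    · exact Or.inl h
    · right
      have : ‖((ContinuousLinearEquiv.refl ℝ E).symm : E →L[ℝ] E)‖₊ = 1 := by
        simp
      rw [this, inv_one]
      exact hK
  exact ⟨injOn_univ.1 (happ.injOn hc), happ.surjective hc⟩

/-- A function that vanishes on the unit sphere and outside it is as Lipschitz on the whole space as
it is on the ball. -/
theorem lipschitzWith_of_lipschitzOnWith_closedBall [NormedSpace ℝ E] {F : Type*}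
    [NormedAddCommGroup F] {g : E → F} {K : ℝ≥0}
    (hg : LipschitzOnWith K g (closedBall 0 1)) (h0 : ∀ x, 1 ≤ ‖x‖ → g x = 0) :
    LipschitzWith K g := by
  -- A segment from the ball to its complement crosses the sphere, where `g` vanishes.
  have key : ∀ x y : E, ‖x‖ ≤ 1 → 1 ≤ ‖y‖ → dist (g x) (g y) ≤ K * dist x y := by
    intro x y hx hy
    have hcont : ContinuousOn (fun t : ℝ => ‖AffineMap.lineMap x y t‖) (Icc 0 1) := by
      have : Continuous fun t : ℝ => (AffineMap.lineMap x y t : E) :=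
        AffineMap.lineMap_continuous
      exact this.norm.continuousOn
    have hmem : (1 : ℝ) ∈ Icc ‖AffineMap.lineMap x y (0 : ℝ)‖ ‖AffineMap.lineMap x y (1 : ℝ)‖ := by
      simp [hx, hy]
    obtain ⟨t, ht, htz⟩ := intermediate_value_Icc zero_le_one hcont hmem
    simp only at htz
    set z : E := AffineMap.lineMap x y t
    have hd := hg.dist_le_mul x (by simpa using hx) z (by simp [htz])
    rw [h0 y hy, ← h0 z htz.ge]
    refine hd.trans (mul_le_mul_of_nonneg_left ?_ K.2)
    rw [dist_comm, dist_lineMap_left, Real.norm_of_nonneg ht.1]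
    exact mul_le_of_le_one_left dist_nonneg ht.2
  refine LipschitzWith.of_dist_le_mul fun x y => ?_
  rcases le_total ‖x‖ 1 with hx | hx <;> rcases le_total ‖y‖ 1 with hy | hy
  · exact hg.dist_le_mul x (by simpa using hx) y (by simpa using hy)
  · exact key x y hx hy
  · rw [dist_comm, dist_comm x]
    exact key y x hy hx
  · rw [h0 x hx, h0 y hy, dist_self]
    positivity

theorem exists_polynomial_eval_eq_det_one_add_smul [NormedSpace ℝ E] [FiniteDimensional ℝ E]
    (A : E →L[ℝ] E) :
    ∃ P : Polynomial ℝ, P.degree < (Module.finrank ℝ E + 1 : ℕ) ∧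
      ∀ t : ℝ, P.eval t = (1 + t • A).det := by
  classical
  let b := Module.finBasis ℝ E
  let M := LinearMap.toMatrix b b (A : E →ₗ[ℝ] E)
  refine ⟨Matrix.det ((Polynomial.X : Polynomial ℝ) • M.map Polynomial.C
    + (1 : Matrix _ _ ℝ).map Polynomial.C), ?_, fun t => ?_⟩
  · refine (Polynomial.degree_le_of_natDegree_le
      (Polynomial.natDegree_det_X_add_C_le M 1)).trans_lt ?_
    simp only [Fintype.card_fin]
    exact_mod_cast Nat.lt_succ_self _
  · have h : (((1 + t • A : E →L[ℝ] E)) : E →ₗ[ℝ] E) = LinearMap.id + t • (A : E →ₗ[ℝ] E) := rfl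
    rw [ContinuousLinearMap.det, h, ← LinearMap.det_toMatrix b,
      ← Polynomial.coe_evalRingHom, RingHom.map_det]
    congr 1
    ext i j
    rcases eq_or_ne i j with rfl | hij
    · simp [M, add_comm, mul_comm t]
    · simp [M, hij, mul_comm t]

theorem exists_pos_forall_det_one_add_pos [NormedSpace ℝ E] [FiniteDimensional ℝ E] :
    ∃ η > 0, ∀ B : E →L[ℝ] E, ‖B‖ < η → 0 < (1 + B).det := by
  have hc : ContinuousAt (fun B : E →L[ℝ] E => (1 + B).det) 0 :=
    (ContinuousLinearMap.continuous_det.comp (continuous_const.add continuous_id)).continuousAt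
  have h0 : (0 : ℝ) < (1 + (0 : E →L[ℝ] E)).det := by
    have : (1 + (0 : E →L[ℝ] E)).det = 1 := by
      rw [add_zero]; exact LinearMap.det_id
    rw [this]; exact one_pos
  obtain ⟨η, hη, h⟩ := Metric.eventually_nhds_iff.1 (hc.eventually (lt_mem_nhds h0))
  exact ⟨η, hη, fun B hB => h (by simpa using hB)⟩

variable [InnerProductSpace ℝ E] [FiniteDimensional ℝ E]

/-- For small `t > 0` the map `id + t • g` permutes the unit ball and has positive Jacobian, so the
change of variables formula computes the volume of the ball. -/
theorem integral_det_one_add_smul_eq [MeasurableSpace E] [BorelSpace E] {g : E → E}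
    {g' : E → E →L[ℝ] E} {K : ℝ≥0}
    (hg : LipschitzWith K g) (hg0 : ∀ x, 1 ≤ ‖x‖ → g x = 0)
    (hg' : ∀ x ∈ ball (0 : E) 1, HasFDerivAt g (g' x) x) :
    ∃ η > 0, ∀ t ∈ Ioo (0 : ℝ) η,
      ∫ x in ball (0 : E) 1, (1 + t • g' x).det = volume.real (ball (0 : E) 1) := by
  obtain ⟨η, hη, hdet⟩ := exists_pos_forall_det_one_add_pos (E := E)
  refine ⟨min 1 η / (K + 1), by positivity, fun t ht => ?_⟩
  have hKpos : (0 : ℝ) < K + 1 := by positivity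
  have htK : t * (K + 1) < min 1 η := (lt_div_iff₀ hKpos).1 ht.2
  have htK1 : t * K < 1 := by nlinarith [min_le_left 1 η, ht.1]
  have htKη : t * K < η := by nlinarith [min_le_right 1 η, ht.1]
  let T : ℝ≥0 := ⟨t, ht.1.le⟩
  have hlip : LipschitzWith (T * K) fun x => t • g x := by
    refine LipschitzWith.of_dist_le_mul fun x y => ?_
    rw [dist_smul₀, Real.norm_of_nonneg ht.1.le]
    calc t * dist (g x) (g y) ≤ t * (K * dist x y) :=
          mul_le_mul_of_nonneg_left (hg.dist_le_mul x y) ht.1.le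
      _ = _ := by push_cast; rw [mul_assoc]; rfl
  have hbij := bijective_id_add_of_lipschitzWith hlip (by exact_mod_cast htK1)
  -- The map is a bijection of `E` that fixes the complement of the ball pointwise.
  have himage : (fun x => x + t • g x) '' ball 0 1 = ball 0 1 := by
    have hfix : ∀ x, x ∉ ball (0 : E) 1 → x + t • g x = x := by
      intro x hx
      rw [hg0 x (by simpa using hx), smul_zero, add_zero]
    ext y
    constructor
    · rintro ⟨x, hx, rfl⟩
      by_contra hy
      have := hbij.1 (hfix _ hy)
      simp only at this
      exact hy (by simpa only [this] using hx)
    · intro hy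
      obtain ⟨x, rfl⟩ := hbij.2 y
      refine ⟨x, ?_, rfl⟩
      by_contra hx
      simp only [hfix x hx] at hy
      exact hx hy
  have hderiv : ∀ x ∈ ball (0 : E) 1,
      HasFDerivWithinAt (fun x => x + t • g x) (1 + t • g' x) (ball 0 1) x := fun x hx =>
    ((hasFDerivAt_id x).add ((hg' x hx).const_smul t)).hasFDerivWithinAt
  have hcv := integral_image_eq_integral_abs_det_fderiv_smul volume measurableSet_ball hderiv
    hbij.1.injOn (fun _ => (1 : ℝ))
  rw [himage] at hcv
  simp only [integral_const, smul_eq_mul, mul_one, measureReal_restrict_apply_univ] at hcv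
  rw [hcv]
  refine setIntegral_congr_fun measurableSet_ball fun x hx => ?_
  have hgx : ‖g' x‖ ≤ K := (hg' x hx).le_of_lipschitz hg
  rw [abs_of_pos]
  refine hdet _ ?_
  rw [norm_smul, Real.norm_of_nonneg ht.1.le]
  exact (mul_le_mul_of_nonneg_left hgx ht.1.le).trans_lt htKη

/-- The identity of `integral_det_one_add_smul_eq` extends to `t = 1`, because both sides are
polynomial in `t`. The extension is by Lagrange interpolation at finitely many small values of `t`,
which spares the study of the coefficients as functions of `x`. -/
theorem integral_det_one_add_eq [MeasurableSpace E] [BorelSpace E] {g : E → E}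
    {g' : E → E →L[ℝ] E} {K : ℝ≥0}
    (hg : LipschitzWith K g) (hg0 : ∀ x, 1 ≤ ‖x‖ → g x = 0)
    (hg' : ∀ x ∈ ball (0 : E) 1, HasFDerivAt g (g' x) x)
    (hcont : ContinuousOn g' (closedBall 0 1)) :
    ∫ x in ball (0 : E) 1, (1 + g' x).det = volume.real (ball (0 : E) 1) := by
  obtain ⟨η, hη, h⟩ := integral_det_one_add_smul_eq hg hg0 hg'
  let n := Module.finrank ℝ E + 1
  let s := Finset.range n
  let v : ℕ → ℝ := fun j => η / (j + 2)
  have hv : InjOn v s := by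
    intro i _ j _ hij
    have : (i : ℝ) + 2 = j + 2 := by
      simp only [v] at hij
      field_simp at hij
      linarith
    exact_mod_cast add_right_cancel this
  have hvmem : ∀ j, v j ∈ Ioo 0 η := fun j =>
    ⟨by positivity, div_lt_self hη (by linarith [(Nat.cast_nonneg j : (0 : ℝ) ≤ j)])⟩
  let w : ℕ → ℝ := fun j => (Lagrange.basis s v j).eval 1
  have hw : ∑ j ∈ s, w j = 1 := by
    have := congrArg (Polynomial.eval 1)
      (Lagrange.sum_basis hv (Finset.nonempty_range_iff.2 (Nat.succ_ne_zero _)))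
    simpa [Polynomial.eval_finsetSum] using this
  -- The weights `w` do not depend on `x`, since the determinants are polynomials of degree `< n`.
  have hpt : ∀ x, (1 + g' x).det = ∑ j ∈ s, w j * (1 + v j • g' x).det := by
    intro x
    obtain ⟨P, hP, hPe⟩ := exists_polynomial_eval_eq_det_one_add_smul (g' x)
    have := congrArg (Polynomial.eval 1) (Lagrange.eq_interpolate (s := s) hv
      (by simpa [s, n] using hP))
    rw [hPe, one_smul] at this
    rw [this, Lagrange.interpolate_apply, Polynomial.eval_finsetSum]
    refine Finset.sum_congr rfl fun j _ => ?_
    rw [Polynomial.eval_mul, Polynomial.eval_C, hPe, mul_comm]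
  have hint : ∀ t : ℝ, IntegrableOn (fun x => (1 + t • g' x).det) (ball (0 : E) 1) := by
    intro t
    have : ContinuousOn (fun x => (1 + t • g' x).det) (closedBall (0 : E) 1) :=
      ContinuousLinearMap.continuous_det.comp_continuousOn
        (continuousOn_const.add (hcont.const_smul t))
    exact (this.integrableOn_compact (isCompact_closedBall 0 1)).mono_set ball_subset_closedBall
  simp_rw [hpt]
  rw [integral_finsetSum _ fun j _ => (hint (v j)).const_mul (w j)]
  simp_rw [integral_const_mul]
  rw [Finset.sum_congr rfl fun j _ => by rw [h (v j) (hvmem j)], ← Finset.sum_mul, hw, one_mul]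

/-- There is no continuously differentiable retraction of the closed unit ball onto the sphere. -/
theorem not_exists_contDiff_retraction_sphere {f : E → E}
    (hf : ∀ x ∈ closedBall (0 : E) 1, ContDiffAt ℝ 1 f x)
    (hfix : ∀ x ∈ sphere (0 : E) 1, f x = x) (hnorm : ∀ x ∈ closedBall (0 : E) 1, ‖f x‖ = 1) :
    False := by
  borelize E
  let g : E → E := fun x => if ‖x‖ ≤ 1 then f x - x else 0
  let g' : E → E →L[ℝ] E := fun x => fderiv ℝ f x - 1
  have hfcont : ContinuousOn (fderiv ℝ f) (closedBall 0 1) := fun x hx =>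
    ((hf x hx).fderiv_right (m := 0) (by norm_num)).continuousAt.continuousWithinAt
  have hcont : ContinuousOn g' (closedBall 0 1) := hfcont.sub continuousOn_const
  obtain ⟨C, hC⟩ := (isCompact_closedBall (0 : E) 1).exists_bound_of_continuousOn hcont
  have hgon : ∀ x ∈ closedBall (0 : E) 1, g x = f x - x := fun x hx =>
    if_pos (by simpa using hx)
  have hfd : ∀ x ∈ closedBall (0 : E) 1, HasFDerivAt (fun x => f x - x) (g' x) x := fun x hx =>
    ((hf x hx).differentiableAt one_ne_zero).hasFDerivAt.sub (hasFDerivAt_id x)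
  have hlip : LipschitzOnWith C.toNNReal g (closedBall 0 1) := by
    refine (convex_closedBall 0 1).lipschitzOnWith_of_nnnorm_hasFDerivWithin_le (𝕜 := ℝ) (f' := g')
      (fun x hx => (hfd x hx).hasFDerivWithinAt.congr hgon (hgon x hx)) fun x hx => ?_
    exact NNReal.le_toNNReal_of_coe_le (hC x hx)
  have hg0 : ∀ x, 1 ≤ ‖x‖ → g x = 0 := by
    intro x hx
    rcases hx.eq_or_lt with h | h
    · simp only [g]
      rw [if_pos h.ge, hfix x (by simpa using h.symm), sub_self]
    · exact if_neg (not_le.2 h)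
  have hg' : ∀ x ∈ ball (0 : E) 1, HasFDerivAt g (g' x) x := fun x hx =>
    (hfd x (ball_subset_closedBall hx)).congr_of_eventuallyEq <|
      (isOpen_ball.eventually_mem hx).mono fun y hy => hgon y (ball_subset_closedBall hy)
  have hvol := integral_det_one_add_eq
    (lipschitzWith_of_lipschitzOnWith_closedBall hlip hg0) hg0 hg' hcont
  -- The range of the derivative is orthogonal to `f x`, because `‖f‖` is constant.
  have hdet : ∀ x ∈ ball (0 : E) 1, (1 + g' x).det = 0 := by
    intro x hx
    have hxc := ball_subset_closedBall hx
    have h1 : 1 + g' x = fderiv ℝ f x := by simp [g']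
    rw [h1]
    have hd := ((hf x hxc).differentiableAt one_ne_zero).hasFDerivAt
    have hconst : HasFDerivAt (fun y => ‖f y‖ ^ 2) (0 : E →L[ℝ] ℝ) x :=
      (hasFDerivAt_const (1 : ℝ) x).congr_of_eventuallyEq <|
        (isOpen_ball.eventually_mem hx).mono fun y hy => by
          simp [hnorm y (ball_subset_closedBall hy)]
    have horth : ∀ v, inner ℝ (f x) (fderiv ℝ f x v) = 0 := by
      intro v
      have := congrArg (fun L : E →L[ℝ] ℝ => L v) (hd.norm_sq.unique hconst)
      simpa using this
    by_contra hne
    obtain ⟨v, hv⟩ := ((fderiv ℝ f x : E →ₗ[ℝ] E).equivOfDetNeZero hne).surjective (f x)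
    have hv' : fderiv ℝ f x v = f x := hv
    have h2 := horth v
    rw [hv', real_inner_self_eq_norm_sq, hnorm x hxc] at h2
    norm_num at h2
  rw [setIntegral_congr_fun measurableSet_ball hdet, integral_zero] at hvol
  have : 0 < volume.real (ball (0 : E) 1) :=
    ENNReal.toReal_pos (measure_ball_pos _ _ one_pos).ne' measure_ball_lt_top.ne
  exact this.ne hvol

/-- Brouwer's theorem for `C¹` maps: without fixed points, sending `x` to the point where the ray
from `p x` through `x` leaves the ball would be a `C¹` retraction onto the sphere. -/
theorem exists_fixedPoint_of_contDiff {p : E → E} (hp : ContDiff ℝ 1 p) (hball : ∀ x, ‖p x‖ ≤ 1) :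
    ∃ x, p x = x := by
  by_contra! hne
  let v : E → E := fun x => x - p x
  have hv : ∀ x, v x ≠ 0 := fun x h => hne x (sub_eq_zero.1 h).symm
  have hvc : ContDiff ℝ 1 v := contDiff_id.sub hp
  let a : E → ℝ := fun x => ‖v x‖ ^ 2
  let b : E → ℝ := fun x => inner ℝ x (v x)
  let d : E → ℝ := fun x => b x ^ 2 + a x * (1 - ‖x‖ ^ 2)
  have ha : ∀ x, 0 < a x := fun x => pow_pos (norm_pos_iff.2 (hv x)) 2
  have hac : ContDiff ℝ 1 a := hvc.norm_sq ℝ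
  have hbc : ContDiff ℝ 1 b := contDiff_id.inner ℝ hvc
  have hdc : ContDiff ℝ 1 d :=
    (hbc.pow 2).add (hac.mul (contDiff_const.sub (contDiff_id.norm_sq ℝ)))
  -- Equality in Cauchy–Schwarz would force `p x = x`.
  have hbs : ∀ x, ‖x‖ = 1 → 0 < b x := by
    intro x hx
    have h1 : b x = 1 - inner ℝ x (p x) := by
      simp [b, v, inner_sub_right, hx]
    have h2 : inner ℝ x (p x) ≠ (1 : ℝ) := by
      intro h
      have h3 : ‖x - p x‖ ^ 2 = ‖x‖ ^ 2 - 2 * inner ℝ x (p x) + ‖p x‖ ^ 2 := norm_sub_sq_real x (p x)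
      rw [h, hx] at h3
      have := hball x
      have h4 := ha x
      simp only [a, v] at h4
      nlinarith [norm_nonneg (p x)]
    have h3 : inner ℝ x (p x) ≤ ‖x‖ * ‖p x‖ := real_inner_le_norm x (p x)
    rw [hx, one_mul] at h3
    rw [h1]
    exact sub_pos.2 (lt_of_le_of_ne (h3.trans (hball x)) h2)
  have hd : ∀ x ∈ closedBall (0 : E) 1, 0 < d x := by
    intro x hx
    have hx' : ‖x‖ ≤ 1 := by simpa using hx
    rcases hx'.eq_or_lt with h | h
    · have := hbs x h
      simp only [d, h]
      nlinarith
    · have : 0 < 1 - ‖x‖ ^ 2 := by nlinarith [norm_nonneg x]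
      have := mul_pos (ha x) this
      simp only [d]
      positivity
  -- `x + s • v x` has norm one iff `a x * s ^ 2 + 2 * b x * s = 1 - ‖x‖ ^ 2`; this has discriminant
  -- `4 * d x`, and `l x` is its larger root, which is zero on the sphere.
  let l : E → ℝ := fun x => (-b x + √(d x)) / a x
  refine not_exists_contDiff_retraction_sphere (f := fun x => x + l x • v x) (fun x hx => ?_)
    (fun x hx => ?_) fun x hx => ?_
  · exact contDiffAt_id.add ((((hbc.contDiffAt.neg).add (hdc.contDiffAt.sqrt (hd x hx).ne')).div
      hac.contDiffAt (ha x).ne').smul hvc.contDiffAt)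
  · have hx1 : ‖x‖ = 1 := by simpa using hx
    have : l x = 0 := by
      simp only [l, d, hx1]
      rw [one_pow, sub_self, mul_zero, add_zero, Real.sqrt_sq (hbs x hx1).le]
      simp
    simp [this]
  · have h1 : ‖x + l x • v x‖ ^ 2 = ‖x‖ ^ 2 + 2 * (l x * b x) + l x ^ 2 * a x := by
      rw [norm_add_sq_real, inner_smul_right, norm_smul, mul_pow, Real.norm_eq_abs, sq_abs]
    have h2 : √(d x) ^ 2 = d x := Real.sq_sqrt (hd x hx).le
    have h3 : l x * a x = -b x + √(d x) := div_mul_cancel₀ _ (ha x).ne'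
    have h4 : a x * (‖x + l x • v x‖ ^ 2 - 1) = 0 := by
      rw [h1]
      have : a x * (‖x‖ ^ 2 + 2 * (l x * b x) + l x ^ 2 * a x - 1)
        = (l x * a x) ^ 2 + 2 * b x * (l x * a x) - a x * (1 - ‖x‖ ^ 2) := by ring
      rw [this, h3]
      simp only [d] at h2 ⊢
      nlinarith
    have h5 : ‖x + l x • v x‖ ^ 2 = 1 := by
      rcases mul_eq_zero.1 h4 with h | h
      · exact absurd h (ha x).ne'
      · linarith
    exact (pow_eq_one_iff_of_nonneg (norm_nonneg _) two_ne_zero).1 h5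

/-- Brouwer's theorem, for continuous maps of the whole space into the unit ball. A map `F` without
fixed points moves the points of the ball by at least some `ε > 0`, and then a smooth map within
`ε` of `F` and with values in the ball has no fixed point either. -/
theorem exists_fixedPoint_of_continuous {F : E → E} (hF : Continuous F) (hball : ∀ x, ‖F x‖ ≤ 1) :
    ∃ x, F x = x := by
  by_contra! hne
  obtain ⟨x₀, -, hmin⟩ := (isCompact_closedBall (0 : E) 1).exists_isMinOn
    (nonempty_closedBall.2 zero_le_one) (continuous_id.dist hF).continuousOn
  have hε : 0 < dist x₀ (F x₀) := dist_pos.2 (hne x₀).symm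
  obtain ⟨p, hp⟩ := exists_contMDiffMap_forall_mem_convex_of_local_const (n := 1)
    (modelWithCornersSelf ℝ E) (t := fun x => ball (F x) (dist x₀ (F x₀)) ∩ closedBall 0 1)
    (fun x => (convex_ball _ _).inter (convex_closedBall _ _)) fun x => ⟨F x, by
      filter_upwards [hF.continuousAt.eventually (ball_mem_nhds (F x) hε)] with y hy
      exact ⟨mem_ball_comm.1 hy, by simpa using hball x⟩⟩
  obtain ⟨x, hx⟩ := exists_fixedPoint_of_contDiff p.contMDiff.contDiff
    (fun x => by simpa using (hp x).2)
  have h1 := hp x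
  have h2 := hmin h1.2
  rw [hx] at h1
  have h3 : dist x₀ (F x₀) ≤ dist x (F x) := hmin h1.2
  exact absurd (mem_ball.1 h1.1) (not_lt.2 h3)

theorem exists_fixedPoint_of_continuous_of_bounded {F : E → E} (hF : Continuous F) {R : ℝ}
    (hR : 0 < R) (hball : ∀ x, ‖F x‖ ≤ R) : ∃ x, F x = x := by
  obtain ⟨x, hx⟩ := exists_fixedPoint_of_continuous (F := fun x => R⁻¹ • F (R • x))
    (by fun_prop) fun x => by
      rw [norm_smul, norm_inv, Real.norm_of_nonneg hR.le]
      exact inv_mul_le_one_of_le₀ (hball _) hR.le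
  refine ⟨R • x, ?_⟩
  rw [← inv_smul_eq_iff₀ hR.ne', hx]

end Brouwer

/-! ### Mixed equilibria of finite games -/

section FiniteNash

open Set

/-- The retraction takes positive parts, adds the mass missing from `1` in equal shares, and
normalizes. -/
theorem exists_continuous_retraction_stdSimplex (A : Type*) [Fintype A] [Nonempty A] :
    ∃ r : (A → ℝ) → A → ℝ, Continuous r ∧ (∀ y, r y ∈ stdSimplex ℝ A) ∧
      ∀ y ∈ stdSimplex ℝ A, r y = y := by
  let s : (A → ℝ) → ℝ := fun y => ∑ a, max (y a) 0
  have hs : Continuous s := by fun_prop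
  have hpos : ∀ y, 0 < max (s y) 1 := fun y => lt_max_of_lt_right one_pos
  have hcard : (0 : ℝ) < Fintype.card A := by exact_mod_cast Fintype.card_pos
  refine ⟨fun y a => (max (y a) 0 + max (1 - s y) 0 / Fintype.card A) / max (s y) 1, ?_,
    fun y => ⟨fun a => ?_, ?_⟩, fun y hy => ?_⟩
  · refine continuous_pi fun a => Continuous.div (by fun_prop) (by fun_prop) fun y => (hpos y).ne'
  · exact div_nonneg (by positivity) (hpos y).le
  · rw [← Finset.sum_div, Finset.sum_add_distrib, Finset.sum_const, Finset.card_univ,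
      nsmul_eq_mul, mul_div_cancel₀ _ hcard.ne', div_eq_one_iff_eq (hpos y).ne']
    change s y + _ = _
    rcases le_total (s y) 1 with h | h
    · rw [max_eq_left (by linarith), max_eq_right h]; ring
    · rw [max_eq_right (by linarith), max_eq_left h]; ring
  · have h1 : s y = 1 := by
      rw [← hy.2]
      exact Finset.sum_congr rfl fun a _ => max_eq_left (hy.1 a)
    ext a
    simp [h1, hy.1 a]

variable {ι : Type*} [Fintype ι] {A : ι → Type*} [∀ i, Fintype (A i)]

/-- Brouwer's theorem on a product of simplices, which is a retract of a Euclidean space. -/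
theorem exists_fixedPoint_pi_stdSimplex [∀ i, Nonempty (A i)]
    {f : (∀ i, A i → ℝ) → ∀ i, A i → ℝ} (hf : Continuous f)
    (hmaps : ∀ x, (∀ i, x i ∈ stdSimplex ℝ (A i)) → ∀ i, f x i ∈ stdSimplex ℝ (A i)) :
    ∃ x, (∀ i, x i ∈ stdSimplex ℝ (A i)) ∧ f x = x := by
  choose r hr hrmem hrid using fun i => exists_continuous_retraction_stdSimplex (A i)
  let ρ : EuclideanSpace ℝ (Σ i, A i) → ∀ i, A i → ℝ := fun z i => r i fun a => z ⟨i, a⟩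
  have hρ : Continuous ρ := continuous_pi fun i => (hr i).comp (by fun_prop)
  have hρmem : ∀ z i, ρ z i ∈ stdSimplex ℝ (A i) := fun z i => hrmem i _
  let F : EuclideanSpace ℝ (Σ i, A i) → EuclideanSpace ℝ (Σ i, A i) := fun z =>
    WithLp.toLp 2 fun p => f (ρ z) p.1 p.2
  have hF : Continuous F := by
    have : Continuous fun z => f (ρ z) := hf.comp hρ
    exact (PiLp.continuous_toLp 2 _).comp (continuous_pi fun p =>
      (continuous_apply p.2).comp ((continuous_apply p.1).comp this))
  have hbound : ∀ z, ‖F z‖ ≤ √(Fintype.card (Σ i, A i)) + 1 := by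
    intro z
    rw [EuclideanSpace.norm_eq]
    refine (Real.sqrt_le_sqrt ?_).trans (le_add_of_nonneg_right zero_le_one)
    have hle : ∀ p : Σ i, A i, ‖F z p‖ ^ 2 ≤ 1 := by
      intro p
      have h := hmaps _ (hρmem z) p.1
      have h1 : f (ρ z) p.1 p.2 ≤ 1 := by
        rw [← h.2]
        exact Finset.single_le_sum (fun a _ => h.1 a) (Finset.mem_univ p.2)
      have h0 := h.1 p.2
      change ‖f (ρ z) p.1 p.2‖ ^ 2 ≤ 1
      rw [Real.norm_of_nonneg h0]
      exact pow_le_one₀ h0 h1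
    simpa using Finset.sum_le_sum fun p (_ : p ∈ Finset.univ) => hle p
  obtain ⟨z, hz⟩ := exists_fixedPoint_of_continuous_of_bounded hF (by positivity) hbound
  have hzf : ∀ i, (fun a => z ⟨i, a⟩) = f (ρ z) i := by
    intro i
    conv_lhs => rw [← hz]
  have hρz : ρ z = f (ρ z) := by
    ext1 i
    rw [← hzf i]
    exact hrid i _ (by rw [hzf i]; exact hmaps _ (hρmem z) i)
  exact ⟨ρ z, hρmem z, hρz.symm⟩

variable [DecidableEq ι]

/-- Expectation of `f` when the coordinates of its argument are drawn independently with the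
weights `x i`. -/
def mixedValue (x : ∀ i, A i → ℝ) (f : (∀ i, A i) → ℝ) : ℝ :=
  ∑ m, (∏ j, x j (m j)) * f m

theorem continuous_mixedValue (f : (∀ i, A i) → ℝ) : Continuous fun x => mixedValue x f := by
  unfold mixedValue
  fun_prop

/-- Redrawing the `i`-th coordinate from its own weights does not change the expectation. -/
theorem sum_mul_mixedValue_update {x : ∀ i, A i → ℝ} {i : ι} (hx : ∑ a, x i a = 1)
    (f : (∀ i, A i) → ℝ) :
    ∑ a, x i a * mixedValue x (fun m => f (Function.update m i a)) = mixedValue x f := by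
  have hprod : ∀ (a : A i) (m : ∀ i, A i),
      x i (m i) * ∏ j, x j (Function.update m i a j) = x i a * ∏ j, x j (m j) := by
    intro a m
    rw [Fintype.prod_eq_mul_prod_compl i, Fintype.prod_eq_mul_prod_compl i (fun j => x j (m j)),
      Function.update_self, mul_left_comm]
    congr 2
    refine Finset.prod_congr rfl fun j hj => ?_
    rw [Function.update_of_ne (by simpa using hj)]
  -- Exchanging an extra draw `a` with the `i`-th coordinate of `m` preserves all weights.
  let e : A i × (∀ i, A i) ≃ A i × (∀ i, A i) :=
    Function.Involutive.toPerm (fun p => (p.2 i, Function.update p.2 i p.1)) fun p => by simp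
  calc ∑ a, x i a * mixedValue x (fun m => f (Function.update m i a))
      = ∑ p : A i × (∀ i, A i),
          x i p.1 * ((∏ j, x j (p.2 j)) * f (Function.update p.2 i p.1)) := by
        rw [Fintype.sum_prod_type]
        simp_rw [mixedValue, Finset.mul_sum]
    _ = ∑ p : A i × (∀ i, A i), x i p.1 * ((∏ j, x j (p.2 j)) * f p.2) := by
        rw [← Equiv.sum_comp e]
        refine Finset.sum_congr rfl fun p _ => ?_
        change x i (p.2 i) * ((∏ j, x j (Function.update p.2 i p.1 j)) *
          f (Function.update (Function.update p.2 i p.1) i (p.2 i))) = _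
        rw [← mul_assoc, hprod, Function.update_idem, Function.update_eq_self, mul_assoc]
    _ = mixedValue x f := by
        rw [Fintype.sum_prod_type]
        simp_rw [← Finset.mul_sum]
        rw [← Finset.sum_mul, hx, one_mul, mixedValue]

/-- Nash's theorem: a finite game has a mixed equilibrium, in the form that no pure deviation helps. -/
theorem exists_mixed_nash_equilibrium [∀ i, Nonempty (A i)] (u : ι → (∀ i, A i) → ℝ) :
    ∃ x : ∀ i, A i → ℝ, (∀ i, x i ∈ stdSimplex ℝ (A i)) ∧
      ∀ i a, mixedValue x (fun m => u i (Function.update m i a)) ≤ mixedValue x (u i) := by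
  -- The Nash map adds to every weight the gain from deviating to that action, and normalizes.
  let gain : (∀ i, A i → ℝ) → ∀ i, A i → ℝ := fun x i a =>
    max (mixedValue x (fun m => u i (Function.update m i a)) - mixedValue x (u i)) 0
  have hgain : ∀ i a, Continuous fun x => gain x i a := fun i a =>
    ((continuous_mixedValue _).sub (continuous_mixedValue _)).max continuous_const
  have hgain0 : ∀ x i a, 0 ≤ gain x i a := fun x i a => le_max_right _ _
  have hden : ∀ x i, 0 < 1 + ∑ a, gain x i a := fun x i =>
    add_pos_of_pos_of_nonneg one_pos (Finset.sum_nonneg fun a _ => hgain0 x i a)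
  obtain ⟨x, hx, hfix⟩ := exists_fixedPoint_pi_stdSimplex
    (f := fun x i a => (x i a + gain x i a) / (1 + ∑ b, gain x i b))
    (continuous_pi fun i => continuous_pi fun a => Continuous.div
      (Continuous.add (by fun_prop) (hgain i a))
      (continuous_const.add (continuous_finsetSum _ fun b _ => hgain i b))
      fun x => (hden x i).ne')
    (fun x hx i => ⟨fun a => div_nonneg (add_nonneg ((hx i).1 a) (hgain0 x i a)) (hden x i).le, by
      rw [← Finset.sum_div, Finset.sum_add_distrib, (hx i).2, div_self (hden x i).ne']⟩)
  refine ⟨x, hx, fun i => ?_⟩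
  -- Some action in the support of `x i` does at most as well as `x i` itself.
  obtain ⟨a, ha, hle⟩ : ∃ a, 0 < x i a ∧
      mixedValue x (fun m => u i (Function.update m i a)) ≤ mixedValue x (u i) := by
    by_contra! hlt
    have hsum := sum_mul_mixedValue_update (hx i).2 (u i)
    have hle : ∀ a ∈ Finset.univ, x i a * mixedValue x (u i) ≤
        x i a * mixedValue x (fun m => u i (Function.update m i a)) := by
      intro a _
      rcases ((hx i).1 a).eq_or_lt with h | h
      · simp [← h]
      · exact mul_le_mul_of_nonneg_left (hlt a h).le h.le
    obtain ⟨a, -, ha⟩ := Finset.exists_ne_zero_of_sum_ne_zero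
      (s := Finset.univ) (f := x i) (by rw [(hx i).2]; exact one_ne_zero)
    have hapos : 0 < x i a := lt_of_le_of_ne ((hx i).1 a) (Ne.symm ha)
    have hstrict := Finset.sum_lt_sum hle
      ⟨a, Finset.mem_univ a, mul_lt_mul_of_pos_left (hlt a hapos) hapos⟩
    rw [hsum, ← Finset.sum_mul, (hx i).2, one_mul] at hstrict
    exact lt_irrefl _ hstrict
  -- For this action the fixed point equation reads `x i a = x i a / (1 + ∑ b, gain x i b)`.
  have hga : gain x i a = 0 := max_eq_right (sub_nonpos.2 hle)
  have hxa : (x i a + gain x i a) / (1 + ∑ b, gain x i b) = x i a :=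
    congrFun (congrFun hfix i) a
  rw [hga, add_zero, div_eq_iff (hden x i).ne'] at hxa
  have hzero : ∑ b, gain x i b = 0 := by
    have : x i a * ∑ b, gain x i b = 0 := by linarith
    exact (mul_eq_zero.1 this).resolve_left ha.ne'
  intro b
  have hb := (Finset.sum_eq_zero_iff_of_nonneg fun b _ => hgain0 x i b).1 hzero b
    (Finset.mem_univ b)
  exact sub_nonpos.1 ((le_max_left _ _).trans hb.le)

end FiniteNash

/-! ### Product measures and finitely supported mixed strategies -/

/-- Replacing the `i`-th factor of a product measure by `τ` amounts to overwriting the `i`-th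
coordinate by an independent draw from `τ`. -/
theorem pi_update_eq_map_prod {ι : Type*} [Fintype ι] [DecidableEq ι] {Ω : ι → Type*}
    [∀ i, MeasurableSpace (Ω i)] (μ : ∀ i, Measure (Ω i)) [∀ i, IsProbabilityMeasure (μ i)]
    (i : ι) (τ : Measure (Ω i)) [IsProbabilityMeasure τ] :
    Measure.pi (Function.update μ i τ) =
      (τ.prod (Measure.pi μ)).map fun p => Function.update p.2 i p.1 := by
  have hprob : ∀ j, IsProbabilityMeasure (Function.update μ i τ j) := by
    intro j
    rcases eq_or_ne j i with rfl | h
    · rwa [Function.update_self]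
    · rw [Function.update_of_ne h]; infer_instance
  have hmeas : Measurable fun p : Ω i × (∀ j, Ω j) => Function.update p.2 i p.1 := by
    refine measurable_pi_iff.2 fun j => ?_
    rcases eq_or_ne j i with rfl | h
    · simpa using measurable_fst
    · simpa [Function.update_of_ne h] using measurable_snd.eval
  refine Measure.pi_eq fun s hs => ?_
  rw [Measure.map_apply hmeas (.univ_pi hs)]
  have hpre : (fun p : Ω i × (∀ j, Ω j) => Function.update p.2 i p.1) ⁻¹' Set.univ.pi s =
      s i ×ˢ Set.univ.pi (Function.update s i Set.univ) := by
    ext p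
    simp only [Set.mem_preimage, Set.mem_univ_pi, Set.mem_prod]
    constructor
    · intro h
      refine ⟨by simpa using h i, fun j => ?_⟩
      rcases eq_or_ne j i with rfl | hj
      · simp
      · simpa [hj] using h j
    · rintro ⟨h1, h2⟩ j
      rcases eq_or_ne j i with rfl | hj
      · simpa using h1
      · simpa [hj] using h2 j
  rw [hpre, Measure.prod_prod, Measure.pi_pi, Fintype.prod_eq_mul_prod_compl i,
    Fintype.prod_eq_mul_prod_compl i (fun j => Function.update μ i τ j (s j))]
  simp only [Function.update_self, measure_univ, one_mul]
  congr 1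
  refine Finset.prod_congr rfl fun j hj => ?_
  have hj' : j ≠ i := by simpa using hj
  rw [Function.update_of_ne hj', Function.update_of_ne hj']

section FiniteSupport

variable {ι : Type*} [Fintype ι] {A : ι → Type*} [∀ i, Fintype (A i)]
  [∀ i, MeasurableSpace (A i)] [∀ i, MeasurableSingletonClass (A i)] {Ω : ι → Type*}
  [∀ i, MeasurableSpace (Ω i)] [∀ i, Countable (Ω i)] [∀ i, MeasurableSingletonClass (Ω i)]
  {ν : ∀ i, Measure (A i)} [∀ i, IsProbabilityMeasure (ν i)] {v : ∀ i, A i → Ω i}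

theorem integrable_pi_map (f : (∀ i, Ω i) → ℝ) :
    Integrable f (Measure.pi fun i => (ν i).map (v i)) := by
  have hv : ∀ i, Measurable (v i) := fun i => measurable_of_countable _
  have hp : ∀ i, IsProbabilityMeasure ((ν i).map (v i)) := fun i =>
    Measure.isProbabilityMeasure_map (hv i).aemeasurable
  rw [← Measure.pi_map_pi fun i => (hv i).aemeasurable]
  exact (integrable_map_measure (measurable_of_countable f).aestronglyMeasurable
    (measurable_of_countable _).aemeasurable).2 .of_finite

theorem integral_pi_map_eq_mixedValue [DecidableEq ι] (f : (∀ i, Ω i) → ℝ) :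
    ∫ m, f m ∂(Measure.pi fun i => (ν i).map (v i)) =
      mixedValue (fun i a => (ν i).real {a}) fun m => f fun j => v j (m j) := by
  have hv : ∀ i, Measurable (v i) := fun i => measurable_of_countable _
  have hp : ∀ i, IsProbabilityMeasure ((ν i).map (v i)) := fun i =>
    Measure.isProbabilityMeasure_map (hv i).aemeasurable
  rw [← Measure.pi_map_pi fun i => (hv i).aemeasurable,
    integral_map (measurable_of_countable _).aemeasurable
      (measurable_of_countable f).aestronglyMeasurable, integral_fintype .of_finite, mixedValue]
  refine Finset.sum_congr rfl fun m _ => ?_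
  rw [smul_eq_mul, measureReal_def, Measure.pi_singleton, ENNReal.toReal_prod]
  rfl

end FiniteSupport

theorem exists_measure_real_singleton_eq {A : Type*} [Fintype A] [MeasurableSpace A]
    [MeasurableSingletonClass A] {x : A → ℝ} (hx : x ∈ stdSimplex ℝ A) :
    ∃ ν : Measure A, IsProbabilityMeasure ν ∧ ∀ a, ν.real {a} = x a := by
  have hsum : ∑ a, ENNReal.ofReal (x a) = 1 := by
    rw [← ENNReal.ofReal_sum_of_nonneg fun a _ => hx.1 a, hx.2, ENNReal.ofReal_one]
  refine ⟨(PMF.ofFintype _ hsum).toMeasure, inferInstance, fun a => ?_⟩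
  rw [measureReal_def, PMF.toMeasure_apply_singleton _ _ (measurableSet_singleton a),
    PMF.ofFintype_apply, ENNReal.toReal_ofReal (hx.1 a)]

/-! ### Extended expectations -/

namespace CollabLearning.ContributionGame

theorem expectation_eq_integral {Ω : Type*} [MeasurableSpace Ω] {μ : Measure Ω} {f : Ω → ℝ}
    (hf : Integrable f μ) : expectation μ f = ((∫ x, f x ∂μ : ℝ) : EReal) := by
  have h1 : ∫⁻ x, ENNReal.ofReal (f x) ∂μ ≠ ⊤ := hf.lintegral_lt_top.ne
  have h2 : ∫⁻ x, ENNReal.ofReal (-f x) ∂μ ≠ ⊤ := hf.neg.lintegral_lt_top.ne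
  rw [expectation, integral_eq_lintegral_pos_part_sub_lintegral_neg_part hf, EReal.coe_sub,
    EReal.coe_ennreal_toReal h1, EReal.coe_ennreal_toReal h2]

/-- A function that is bounded above and not integrable has an infinite negative part. -/
theorem expectation_eq_bot {Ω : Type*} [MeasurableSpace Ω] {μ : Measure Ω} [IsFiniteMeasure μ]
    {f : Ω → ℝ} (hmeas : Measurable f) {C : ℝ} (hC : ∀ x, f x ≤ C) (hf : ¬ Integrable f μ) :
    expectation μ f = ⊥ := by
  have hneg : ∫⁻ x, ENNReal.ofReal (-f x) ∂μ = ⊤ := by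
    by_contra h
    refine hf ⟨hmeas.aestronglyMeasurable, ?_⟩
    rw [hasFiniteIntegral_iff_norm]
    have hle : ∀ x, ENNReal.ofReal ‖f x‖ ≤ ENNReal.ofReal C + ENNReal.ofReal (-f x) := by
      intro x
      rcases le_total 0 (f x) with h0 | h0
      · rw [Real.norm_of_nonneg h0]
        exact (ENNReal.ofReal_le_ofReal (hC x)).trans le_self_add
      · rw [Real.norm_of_nonpos h0]
        exact le_add_self
    refine (lintegral_mono hle).trans_lt ?_
    rw [lintegral_add_left measurable_const, lintegral_const]
    exact ENNReal.add_lt_top.2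
      ⟨ENNReal.mul_lt_top ENNReal.ofReal_lt_top (measure_lt_top _ _), lt_top_iff_ne_top.2 h⟩
  rw [expectation, hneg, EReal.coe_ennreal_top, sub_eq_add_neg, EReal.neg_top, EReal.add_bot]

/-! ### The contribution game -/

variable {k : ℕ} {X Y : Type*} [MeasurableSpace X] (G : ContributionGame k X Y)

theorem accuracy_le_one (i : Fin k) (m : Fin k → ℕ) : G.accuracy i m ≤ 1 := by
  unfold accuracy
  split_ifs <;> norm_num

theorem utility_le_one (i : Fin k) (m : Fin k → ℕ) : G.utility i m ≤ 1 := by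
  have := mul_nonneg (G.c_pos i).le (Nat.cast_nonneg (α := ℝ) (m i))
  have := G.accuracy_le_one i m
  unfold utility
  linarith

variable {G}

/-- An agent that contributes its solo count meets its requirement whatever the others do. -/
theorem utility_eq_of_isSoloCount (hmono : G.Monotonicity) {i : Fin k} {n : ℕ}
    (hn : G.IsSoloCount i n) {m : Fin k → ℕ} (hm : m i = n) :
    G.utility i m = 1 - G.c i * n := by
  have h := hmono i (Pi.single i n) m (fun j => by
    rcases eq_or_ne j i with rfl | hj
    · simp [hm]
    · simp [hj]) (by simp [hm])
  have h1 : G.accuracy i (Pi.single i n) = 1 := if_pos hn.1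
  unfold utility at h ⊢
  rw [h1, Pi.single_eq_same, hm] at h
  rw [hm]
  linarith [G.accuracy_le_one i m]

/-- Contributing more than the solo count is dominated by contributing the solo count. -/
theorem utility_update_le_of_isSoloCount (hmono : G.Monotonicity) {i : Fin k} {n n' : ℕ}
    (hn : G.IsSoloCount i n) (hle : n ≤ n') (m : Fin k → ℕ) :
    G.utility i (Function.update m i n') ≤ G.utility i (Function.update m i n) := by
  rw [utility_eq_of_isSoloCount hmono hn (Function.update_self i n m)]
  have h1 := G.accuracy_le_one i (Function.update m i n')
  have h2 : G.c i * n ≤ G.c i * n' :=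
    mul_le_mul_of_nonneg_left (Nat.cast_le.2 hle) (G.c_pos i).le
  unfold utility
  rw [Function.update_self]
  linarith

/-- If no pure deviation of agent `i` earns more than `V`, then no mixed deviation does. -/
theorem expectedUtility_update_le
    {σ : Fin k → ProbabilityMeasure ℕ} {i : Fin k} {V : ℝ}
    (hV : ∀ n, ∫ m, G.utility i (Function.update m i n)
      ∂(Measure.pi fun j => (σ j : Measure ℕ)) ≤ V)
    (τ : ProbabilityMeasure ℕ) : G.expectedUtility i (Function.update σ i τ) ≤ V := by
  have hμ : (Measure.pi fun j => (Function.update σ i τ j : Measure ℕ)) =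
      ((τ : Measure ℕ).prod (Measure.pi fun j => (σ j : Measure ℕ))).map
        fun p => Function.update p.2 i p.1 := by
    have hpi := pi_update_eq_map_prod (fun j => (σ j : Measure ℕ)) i τ
    rw [← hpi]
    congr 1
    ext1 j
    rcases eq_or_ne j i with rfl | hj
    · simp
    · simp [hj]
  rw [expectedUtility]
  by_cases hint : Integrable (G.utility i)
      (Measure.pi fun j => (Function.update σ i τ j : Measure ℕ))
  · rw [expectation_eq_integral hint, EReal.coe_le_coe_iff]
    have hmu : AEStronglyMeasurable (G.utility i)
        (((τ : Measure ℕ).prod (Measure.pi fun j => (σ j : Measure ℕ))).map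
          fun p => Function.update p.2 i p.1) :=
      (measurable_of_countable _).aestronglyMeasurable
    have hup : AEMeasurable (fun p : ℕ × (Fin k → ℕ) => Function.update p.2 i p.1)
        ((τ : Measure ℕ).prod (Measure.pi fun j => (σ j : Measure ℕ))) :=
      (measurable_of_countable _).aemeasurable
    rw [hμ] at hint ⊢
    have hint' := (integrable_map_measure hmu hup).1 hint
    rw [integral_map hup hmu]
    refine (integral_prod _ hint').trans_le ?_
    refine (integral_mono hint'.integral_prod_left (integrable_const V) hV).trans ?_
    simp
  · rw [expectation_eq_bot (measurable_of_countable _) (G.utility_le_one i) hint]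
    exact bot_le

end CollabLearning.ContributionGame

theorem mainTheorem8 {k : ℕ} {X Y : Type*} [MeasurableSpace X]
    (G : CollabLearning.ContributionGame k X Y)
    (hself : G.SelfSufficient) (hmono : G.Monotonicity) :
    ∃ σ : Fin k → MeasureTheory.ProbabilityMeasure ℕ, G.IsNashEquilibrium σ := by
  choose n hn _ using hself
  let N := Finset.univ.sup n
  have hnN : ∀ i, n i < N + 1 := fun i => Nat.lt_succ_of_le (Finset.le_sup (Finset.mem_univ i))
  obtain ⟨x, hx, hnash⟩ := exists_mixed_nash_equilibrium (A := fun _ : Fin k => Fin (N + 1))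
    fun i m => G.utility i fun j => (m j : ℕ)
  choose ν hν hνx using fun i => exists_measure_real_singleton_eq (hx i)
  have hval : Measurable (Fin.val : Fin (N + 1) → ℕ) := measurable_of_countable _
  let σ : Fin k → ProbabilityMeasure ℕ := fun i =>
    ⟨(ν i).map Fin.val, Measure.isProbabilityMeasure_map hval.aemeasurable⟩
  have hσ : ∀ f : (Fin k → ℕ) → ℝ, ∫ m, f m ∂(Measure.pi fun j => (σ j : Measure ℕ)) =
      mixedValue x fun m => f fun j => (m j : ℕ) := by
    intro f
    have hx' : x = fun i a => (ν i).real {a} := funext fun i => funext fun a => (hνx i a).symm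
    rw [hx']
    exact integral_pi_map_eq_mixedValue (ν := ν) (v := fun _ => Fin.val) f
  have hcast : ∀ (m : Fin k → Fin (N + 1)) (i : Fin k) (a : Fin (N + 1)),
      (fun j => (Function.update m i a j : ℕ)) = Function.update (fun j => (m j : ℕ)) i (a : ℕ) := by
    intro m i a
    ext j
    rcases eq_or_ne j i with rfl | hj
    · simp
    · simp [hj]
  have hsmall : ∀ i (a : ℕ), a < N + 1 →
      mixedValue x (fun m => G.utility i (Function.update (fun j => (m j : ℕ)) i a)) ≤
        mixedValue x fun m => G.utility i fun j => (m j : ℕ) := by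
    intro i a ha
    simpa only [hcast] using hnash i ⟨a, ha⟩
  refine ⟨σ, fun i τ => ?_⟩
  have hval : G.expectedUtility i σ =
      (mixedValue x (fun m => G.utility i fun j => (m j : ℕ)) : ℝ) := by
    have hint : Integrable (G.utility i) (Measure.pi fun j => (σ j : Measure ℕ)) :=
      integrable_pi_map (ν := ν) (v := fun _ => Fin.val) _
    rw [CollabLearning.ContributionGame.expectedUtility,
      CollabLearning.ContributionGame.expectation_eq_integral hint, hσ]
  rw [hval]
  refine CollabLearning.ContributionGame.expectedUtility_update_le (fun a => ?_) τ
  rw [hσ]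
  rcases lt_or_ge a (N + 1) with ha | ha
  · exact hsmall i a ha
  -- Contributions above `N` are dominated by the solo count.
  · refine le_trans ?_ (hsmall i (n i) (hnN i))
    refine Finset.sum_le_sum fun m _ => mul_le_mul_of_nonneg_left ?_
      (Finset.prod_nonneg fun j _ => (hx j).1 _)
    exact CollabLearning.ContributionGame.utility_update_le_of_isSoloCount hmono (hn i)
      ((hnN i).le.trans ha) _
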